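/- Let $\mathfrak H$ be a complex Hilbert space and let $S$ be a closed nonnegative symmetric (not necessarily densely defined) linear operator in $\mathfrak H$. Put $B=(I-S)(I+S)^{-1}$, with domain $\operatorname{dom}B=\operatorname{ran}(I+S)$, and $\mathfrak N=\mathfrak H\ominus\operatorname{dom}B$. An $sc$-extension of $B$ is a selfadjoint contraction $\widetilde B$, defined on all of $\mathfrak H$, that extends $B$; let $B_\mu$ and $B_M$ be the least and the greatest $sc$-extension of $B$. Let $\widetilde B_0,\widetilde B_1$ be $sc$-extensions of $B$ such that $$\widetilde B_0\le\widetilde B_1,\qquad \ker(\widetilde B_1-\widetilde B_0)=\operatorname{dom}B,$$ $$\operatorname{ran}(\widetilde B_1-\widetilde B_0)^{1/2}\cap\operatorname{ran}(\widetilde B_0-B_\mu)^{1/2}=\operatorname{ran}(\widetilde B_1-\widetilde B_0)^{1/2}\cap\operatorname{ran}(B_M-\widetilde B_1)^{1/2}=\{0\},$$ and such that $\ker(I+\widetilde B_k)=\{0\}$ for $k=0,1$, so that $\widetilde S_k=(I-\widetilde B_k)(I+\widetilde B_k)^{-1}$, $k=0,1$, are (single-valued) nonnegative selfadjoint operator extensions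 of $S$. For $\lambda\in\mathbb C\setminus\mathbb R_+$, $\mathbb R_+=[0,\infty)$, define the bounded operators on $\mathfrak N$ $$\widetilde{\mathcal Q}_0(\lambda)=-I_{\mathfrak N}+\tfrac{\lambda+1}{2}(\widetilde B_1-\widetilde B_0)^{1/2}\bigl(I+(\lambda+1)(\widetilde S_0-\lambda I)^{-1}\bigr)(\widetilde B_1-\widetilde B_0)^{1/2}\!\upharpoonright\mathfrak N,$$ $$\widetilde{\mathcal Q}_1(\lambda)=I_{\mathfrak N}+\tfrac{\lambda+1}{2}(\widetilde B_1-\widetilde B_0)^{1/2}\bigl(I+(\lambda+1)(\widetilde S_1-\lambda I)^{-1}\bigr)(\widetilde B_1-\widetilde B_0)^{1/2}\!\upharpoonright\mathfrak N.$$ Then: (a) $\widetilde{\mathcal Q}_0$ belongs to the class $\mathcal S_F(\mathfrak N)$: it is a Herglotz–Nevanlinna function (that is, $\mathcal M(\bar\lambda)=\mathcal M(\lambda)^*$ and $\operatorname{Im}\mathcal M(\lambda)\ge0$ for $\operatorname{Im}\lambda>0$), it is holomorphic on $\mathbb C\setminus\mathbb R_+$ with values in the bounded operators on $\mathfrak N$,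 $\mathcal M(\lambda)$ has a bounded inverse for all $\lambda\in\mathbb C\setminus\mathbb R_+$, $\lim_{x\uparrow0}\mathcal M(x)=0$ strongly, $\lim_{x\to-\infty}(\mathcal M(x)g,g)=-\infty$ for each $g\ne0$, and $\lim_{x\to-\infty}x^{-1}\mathcal M(x)=0$ strongly. (b) $\widetilde{\mathcal Q}_1$ belongs to the class $\mathcal S_K(\mathfrak N)$: it is a Herglotz–Nevanlinna function, holomorphic on $\mathbb C\setminus\mathbb R_+$ with values in the bounded operators on $\mathfrak N$, $\mathcal N(\lambda)$ has a bounded inverse for all $\lambda\in\mathbb C\setminus\mathbb R_+$, $\lim_{x\uparrow0}(\mathcal N(x)g,g)=+\infty$ for each $g\ne0$, $\lim_{x\to-\infty}\mathcal N(x)=0$ strongly, and $\lim_{x\to-\infty}x(\mathcal N(x)g,g)=-\infty$ for each $g\ne0$. (c) $\widetilde{\mathcal Q}_0(\lambda)\widetilde{\mathcal Q}_1(\lambda)=\widetilde{\mathcal Q}_1(\lambda)\widetilde{\mathcal Q}_0(\lambda)=-I_{\mathfrak N}$ for each $\lambda\in\mathbb C\setminus\mathbb R_+$. -/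

import Mathlib

open Filter Topology

namespace QFun

noncomputable section

variable {H : Type*} [NormedAddCommGroup H] [InnerProductSpace ℂ H]

/-- The linear operator `S`, defined on the (not necessarily dense) linear subspace `S.domain`,
is symmetric and nonnegative. -/
structure IsNonnegSymmetric (S : H →ₗ.[ℂ] H) : Prop where
  symm : ∀ f g : S.domain, inner ℂ (S f) (g : H) = inner ℂ (f : H) (S g)
  nonneg : ∀ f : S.domain, 0 ≤ (inner ℂ (f : H) (S f)).re

/-- The linear map `(f, f') ↦ (f + f', f - f')` on pairs. -/
def cayleyMap (H : Type*) [NormedAddCommGroup H] [InnerProductSpace ℂ H] :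
    (H × H) →ₗ[ℂ] (H × H) :=
  (LinearMap.fst ℂ H H + LinearMap.snd ℂ H H).prod
    (LinearMap.fst ℂ H H - LinearMap.snd ℂ H H)

/-- The linear fractional (Cayley) transform `(I - T)(I + T)⁻¹` of an operator `T` with
`ker (I + T) = 0`: the operator with graph `{(f + T f, f - T f) : f ∈ dom T}`.
It is its own inverse transform. -/
def cayley (T : H →ₗ.[ℂ] H) : H →ₗ.[ℂ] H :=
  (T.graph.map (cayleyMap H)).toLinearPMap

theorem mem_graph_cayley {T : H →ₗ.[ℂ] H} (hT : ∀ f : T.domain, (f : H) + T f = 0 → (f : H) = 0)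
    {p : H × H} : p ∈ (cayley T).graph ↔ ∃ f : T.domain, p = ((f : H) + T f, (f : H) - T f) := by
  have key : ∀ p : H × H, p ∈ T.graph.map (cayleyMap H) ↔
      ∃ f : T.domain, p = ((f : H) + T f, (f : H) - T f) := by
    intro p
    constructor
    · rintro ⟨q, hq, rfl⟩
      obtain ⟨f, rfl⟩ := (LinearPMap.mem_graph_iff' T).1 hq
      exact ⟨f, rfl⟩
    · rintro ⟨f, rfl⟩
      exact ⟨_, T.mem_graph f, rfl⟩
  rw [cayley, Submodule.toLinearPMap_graph_eq, key]
  intro x hx h0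
  obtain ⟨f, rfl⟩ := (key x).1 hx
  have hf := hT f h0
  have h1 : f = 0 := Subtype.ext hf
  simp [h1]

/-- A bounded everywhere defined operator, as an operator with domain `⊤`. -/
def ofBounded (A : H →L[ℂ] H) : H →ₗ.[ℂ] H := (A : H →ₗ[ℂ] H).toPMap ⊤

/-- `R` is the bounded resolvent `(T - z I)⁻¹`, defined on the whole space. -/
structure IsResolvent (T : H →ₗ.[ℂ] H) (z : ℂ) (R : H →L[ℂ] H) : Prop where
  mem_domain : ∀ x, R x ∈ T.domain
  right_inv : ∀ x, T ⟨R x, mem_domain x⟩ - z • R x = x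
  left_inv : ∀ f : T.domain, R (T f - z • (f : H)) = f

theorem IsResolvent.unique {T : H →ₗ.[ℂ] H} {z : ℂ} {R R' : H →L[ℂ] H}
    (h : IsResolvent T z R) (h' : IsResolvent T z R') : R = R' := by
  ext x
  have h1 := h'.left_inv ⟨R x, h.mem_domain x⟩
  rw [h.right_inv x] at h1
  exact h1.symm

open Classical in
/-- The resolvent `(T - z I)⁻¹ ∈ L(H)` for `z` in the resolvent set of `T`
(and `0` outside of the resolvent set). -/
def resolvent (T : H →ₗ.[ℂ] H) (z : ℂ) : H →L[ℂ] H :=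
  if h : ∃ R, IsResolvent T z R then h.choose else 0

theorem IsResolvent.resolvent_eq {T : H →ₗ.[ℂ] H} {z : ℂ} {R : H →L[ℂ] H}
    (h : IsResolvent T z R) : resolvent T z = R := by
  have h' : ∃ R, IsResolvent T z R := ⟨R, h⟩
  rw [resolvent, dif_pos h']
  exact h'.choose_spec.unique h

variable [CompleteSpace H]

/-- The set of selfadjoint contractive extensions (`sc`-extensions) of the operator `B`. -/
def scExt (B : H →ₗ.[ℂ] H) : Set (H →L[ℂ] H) :=
  {A | IsSelfAdjoint A ∧ ‖A‖ ≤ 1 ∧ ∀ f : B.domain, A f = B f}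

open Classical in
/-- The left endpoint `B_μ` of the operator interval of all `sc`-extensions of `B`:
the least `sc`-extension for the order of selfadjoint operators. -/
def extMin (B : H →ₗ.[ℂ] H) : H →L[ℂ] H :=
  if h : ∃ A, IsLeast (scExt B) A then h.choose else 0

open Classical in
/-- The right endpoint `B_M` of the operator interval of all `sc`-extensions of `B`:
the greatest `sc`-extension for the order of selfadjoint operators. -/
def extMax (B : H →ₗ.[ℂ] H) : H →L[ℂ] H :=
  if h : ∃ A, IsGreatest (scExt B) A then h.choose else 0

theorem le_iff_re {A C : H →L[ℂ] H} (hA : IsSelfAdjoint A) (hC : IsSelfAdjoint C) :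
    A ≤ C ↔ ∀ x, (inner ℂ (A x) x).re ≤ (inner ℂ (C x) x).re := by
  rw [ContinuousLinearMap.le_def, ContinuousLinearMap.isPositive_def']
  constructor
  · rintro ⟨-, h⟩ x
    have := h x
    simp [ContinuousLinearMap.reApplyInnerSelf, inner_sub_left] at this
    exact this
  · intro h
    refine ⟨hC.sub hA, fun x => ?_⟩
    have := h x
    simp [ContinuousLinearMap.reApplyInnerSelf, inner_sub_left]
    exact this

theorem mem_scExt_iff {B : H →ₗ.[ℂ] H} {A : H →L[ℂ] H} :
    A ∈ scExt B ↔ IsSelfAdjoint A ∧ (-1 ≤ A ∧ A ≤ 1) ∧ ∀ f : B.domain, A f = B f := by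
  have h1 : IsSelfAdjoint (1 : H →L[ℂ] H) := IsSelfAdjoint.one _
  refine and_congr_right fun hA => and_congr_left fun _ => ?_
  rw [le_iff_re h1.neg hA, le_iff_re hA h1]
  constructor
  · intro hn
    have key : ∀ x, |(inner ℂ (A x) x).re| ≤ ‖x‖ ^ 2 := fun x => by
      refine (Complex.abs_re_le_norm _).trans ((norm_inner_le_norm _ _).trans ?_)
      have := A.le_of_opNorm_le hn x
      nlinarith [norm_nonneg x]
    refine ⟨fun x => ?_, fun x => ?_⟩
    · have := (abs_le.1 (key x)).1
      simpa [← Complex.ofReal_pow] using this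
    · have := (abs_le.1 (key x)).2
      simpa [← Complex.ofReal_pow] using this
  · rintro ⟨hl, hu⟩
    refine A.opNorm_le_bound zero_le_one fun x => ?_
    have hs : ∀ u v, inner ℂ (A u) v = inner ℂ u (A v) := hA.isSymmetric
    have a := hl (x - A x)
    have b := hu (x + A x)
    have e : ∀ u : H, (inner ℂ u u).re = ‖u‖ ^ 2 := fun u => by simp [← Complex.ofReal_pow]
    have e1 := e x
    have e2 := e (A x)
    have e3 : inner ℂ (A (A x)) x = inner ℂ (A x) (A x) := hs _ _
    simp only [neg_apply, one_apply_eq_self, map_sub, map_add,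
      inner_sub_left, inner_sub_right, inner_add_left,
      inner_add_right, inner_neg_left, Complex.sub_re, Complex.add_re, Complex.neg_re, e3] at a b
    rw [one_mul]
    refine le_of_sq_le_sq ?_ (norm_nonneg x)
    rw [← e1, ← e2]
    linarith

theorem exists_isLeast_scExt {B : H →ₗ.[ℂ] H} (hB : (scExt B).Nonempty) :
    ∃ A, IsLeast (scExt B) A := by
  obtain ⟨A, hA⟩ := hB
  obtain ⟨hsa, ⟨hl, hu⟩, hext⟩ := mem_scExt_iff.1 hA
  have root : ∀ C : H →L[ℂ] H, -1 ≤ C → ∃ T : H →L[ℂ] H, IsSelfAdjoint T ∧ T * T = 1 + C := by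
    intro C hC
    have h0 : 0 ≤ 1 + C := by simpa using add_le_add_right hC 1
    exact ⟨CFC.sqrt (1 + C), (CFC.sqrt_nonneg _).isSelfAdjoint, CFC.sqrt_mul_sqrt_self _ h0⟩
  obtain ⟨T, hT, hTT⟩ := root A hl
  have hTs : ∀ u v, inner ℂ (T u) v = inner ℂ u (T v) := hT.isSymmetric
  have hTT' : ∀ x, T (T x) = x + A x := fun x => by
    simpa using congrArg (fun F : H →L[ℂ] H => F x) hTT
  let D : Submodule ℂ H := B.domain.map (T : H →ₗ[ℂ] H)
  let P : H →L[ℂ] H := Dᗮ.starProjection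
  have hP : IsSelfAdjoint P := isSelfAdjoint_starProjection _
  have hPs : ∀ u v, inner ℂ (P u) v = inner ℂ u (P v) := hP.isSymmetric
  have hPP : ∀ x, P (P x) = P x := fun x =>
    Submodule.starProjection_eq_self_iff.2 (Submodule.starProjection_apply_mem _ _)
  have hPD : ∀ y ∈ D, P y = 0 := fun y hy =>
    (Submodule.starProjection_apply_eq_zero_iff _).2 (Submodule.le_orthogonal_orthogonal _ hy)
  have hsa' : IsSelfAdjoint (T * P * T) := by
    have := hP.conjugate T
    rwa [hT.star_eq] at this
  -- the quadratic form of `T P T`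
  have hform : ∀ x, (inner ℂ ((T * P * T) x) x).re = ‖P (T x)‖ ^ 2 := fun x => by
    have h1 : inner ℂ ((T * P * T) x) x = inner ℂ (P (T x)) (P (T x)) := by
      change inner ℂ (T (P (T x))) x = _
      rw [hTs, hPs (T x) (P (T x)), hPP, hPs]
    rw [h1, inner_self_eq_norm_sq_to_K]
    simp [← Complex.ofReal_pow]
  -- Pythagoras
  have hpyth : ∀ x, ‖P x‖ ^ 2 + ‖x - P x‖ ^ 2 = ‖x‖ ^ 2 := fun x => by
    have h0 : inner ℂ (P x) (x - P x) = 0 := by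
      rw [hPs, map_sub, hPP, sub_self, inner_zero_right]
    have := norm_add_sq_eq_norm_sq_add_norm_sq_of_inner_eq_zero (P x) (x - P x) h0
    rw [add_sub_cancel] at this
    nlinarith
  have hone : IsSelfAdjoint (1 : H →L[ℂ] H) := IsSelfAdjoint.one _
  have hself : ∀ x : H, (inner ℂ x x).re = ‖x‖ ^ 2 := fun x => by simp [← Complex.ofReal_pow]
  have hTn : ∀ x, ‖T x‖ ^ 2 = ‖x‖ ^ 2 + (inner ℂ (A x) x).re := fun x => by
    rw [← hself, ← hself, ← hTs, hTT', inner_add_left, Complex.add_re]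
  have hAsa := hsa.sub hsa'
  have hAre : ∀ x, (inner ℂ ((A - T * P * T) x) x).re = (inner ℂ (A x) x).re - ‖P (T x)‖ ^ 2 :=
    fun x => by
      rw [← hform, sub_apply, inner_sub_left, Complex.sub_re]
  refine ⟨A - T * P * T, mem_scExt_iff.2 ⟨hAsa, ⟨?_, ?_⟩, ?_⟩, ?_⟩
  · rw [le_iff_re hone.neg hAsa]
    intro x
    rw [hAre, neg_apply, inner_neg_left, Complex.neg_re,
      one_apply_eq_self, hself]
    nlinarith [hpyth (T x), hTn x, sq_nonneg ‖T x - P (T x)‖]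
  · rw [le_iff_re hAsa hone]
    intro x
    have := (le_iff_re hsa hone).1 hu x
    rw [hAre]
    nlinarith [sq_nonneg ‖P (T x)‖]
  · intro f
    have : P (T f) = 0 := hPD _ ⟨f, f.2, rfl⟩
    simp [this, hext f]
  · intro C hC
    obtain ⟨hCsa, ⟨hCl, -⟩, hCext⟩ := mem_scExt_iff.1 hC
    obtain ⟨R, hR, hRR⟩ := root C hCl
    have hRs : ∀ u v, inner ℂ (R u) v = inner ℂ u (R v) := hR.isSymmetric
    have hRR' : ∀ x, R (R x) = x + C x := fun x => by
      simpa using congrArg (fun F : H →L[ℂ] H => F x) hRR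
    have hRn : ∀ x, ‖R x‖ ^ 2 = ‖x‖ ^ 2 + (inner ℂ (C x) x).re := fun x => by
      rw [← hself, ← hself, ← hRs, hRR', inner_add_left, Complex.add_re]
    rw [le_iff_re hAsa hCsa]
    intro x
    rw [hAre]
    set v := T x - P (T x) with hv
    have hAC : ∀ f ∈ B.domain, A f = C f := fun f hf => by
      rw [hext ⟨f, hf⟩, hCext ⟨f, hf⟩]
    have hb : ∀ y ∈ D, ‖inner ℂ v y‖ ≤ ‖R x‖ * ‖y‖ := by
      rintro _ ⟨f, hf, rfl⟩
      change ‖inner ℂ v (T f)‖ ≤ ‖R x‖ * ‖T f‖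
      have h1 : inner ℂ v (T f) = inner ℂ (R x) (R f) := by
        have h0 : P (T f) = 0 := hPD _ ⟨f, hf, rfl⟩
        rw [hv, inner_sub_left, hPs, h0, inner_zero_right, sub_zero, hTs, hTT',
          hRs, hRR', hAC f hf]
      have h2 : ‖R f‖ = ‖T f‖ := by
        have : ‖R f‖ ^ 2 = ‖T f‖ ^ 2 := by rw [hRn, hTn, hAC f hf]
        exact (sq_eq_sq₀ (norm_nonneg _) (norm_nonneg _)).1 this
      rw [h1, ← h2]
      exact norm_inner_le_norm _ _
    have hcl : IsClosed {y : H | ‖inner ℂ v y‖ ≤ ‖R x‖ * ‖y‖} :=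
      isClosed_le (by fun_prop) (by fun_prop)
    have hvD : v ∈ closure (D : Set H) := by
      rw [← Submodule.topologicalClosure_coe, ← Submodule.orthogonal_orthogonal_eq_closure]
      exact Submodule.sub_starProjection_mem_orthogonal _
    have hvv : ‖inner ℂ v v‖ ≤ ‖R x‖ * ‖v‖ := closure_minimal hb hcl hvD
    have h3 : ‖v‖ ≤ ‖R x‖ := by
      rw [inner_self_eq_norm_sq_to_K, norm_pow] at hvv
      simp only [RCLike.norm_ofReal, abs_norm] at hvv
      by_contra! h
      nlinarith [norm_nonneg (R x), norm_nonneg v]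
    nlinarith [hpyth (T x), hTn x, hRn x, norm_nonneg v, norm_nonneg (R x)]

/-- The endpoint `extMin B` is what its name says as soon as `B` has an `sc`-extension. -/
theorem isLeast_extMin {B : H →ₗ.[ℂ] H} (hB : (scExt B).Nonempty) :
    IsLeast (scExt B) (extMin B) := by
  rw [extMin, dif_pos (exists_isLeast_scExt hB)]
  exact (exists_isLeast_scExt hB).choose_spec

/-- The endpoint `extMax B` is what its name says as soon as `B` has an `sc`-extension. -/
theorem isGreatest_extMax {B : H →ₗ.[ℂ] H} (hB : (scExt B).Nonempty) :
    IsGreatest (scExt B) (extMax B) := by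
  have hneg : ∀ {B : H →ₗ.[ℂ] H} {A}, A ∈ scExt B → -A ∈ scExt (-B) := by
    rintro B A ⟨h1, h2, h3⟩
    exact ⟨h1.neg, by rwa [norm_neg], fun f => congrArg Neg.neg (h3 f)⟩
  have h : ∃ A, IsGreatest (scExt B) A := by
    obtain ⟨A, hA⟩ := hB
    obtain ⟨C, hC, hC'⟩ := exists_isLeast_scExt ⟨-A, hneg hA⟩
    refine ⟨-C, by simpa using hneg hC, fun D hD => ?_⟩
    exact le_neg.1 (hC' (hneg hD))
  rw [extMax, dif_pos h]
  exact h.choose_spec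

/-- `{B₀, B₁}` is a pair of `sc`-extensions of `B` with `B₀ ≤ B₁`, `ker (B₁ - B₀) = dom B` and
`ran (B₁ - B₀)^{1/2} ∩ ran (B₀ - B_μ)^{1/2} = ran (B₁ - B₀)^{1/2} ∩ ran (B_M - B₁)^{1/2} = {0}`. -/
structure IsSpecialPair (B : H →ₗ.[ℂ] H) (B₀ B₁ : H →L[ℂ] H) : Prop where
  sc₀ : B₀ ∈ scExt B
  sc₁ : B₁ ∈ scExt B
  le : B₀ ≤ B₁
  ker_eq : (B₁ - B₀).ker = B.domain
  range_min : (CFC.sqrt (B₁ - B₀)).range ⊓ (CFC.sqrt (B₀ - extMin B)).range = ⊥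
  range_max : (CFC.sqrt (B₁ - B₀)).range ⊓ (CFC.sqrt (extMax B - B₁)).range = ⊥

/-- The defect subspace `𝔑 = H ⊖ dom B` of the operator `B`. -/
abbrev defect (B : H →ₗ.[ℂ] H) : Submodule ℂ H := B.domainᗮ

/-- The compression `P_N T ↾ N` to a subspace of the form `Kᗮ`. It is the restriction `T ↾ N`
whenever `T` maps `N` into `N`. -/
def compress (K : Submodule ℂ H) (T : H →L[ℂ] H) : Kᗮ →L[ℂ] Kᗮ :=
  Kᗮ.orthogonalProjectionOnto ∘L T ∘L Kᗮ.subtypeL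

/-- The set `ℂ ∖ ℝ₊`, where `ℝ₊ = [0, ∞)`. -/
def slit : Set ℂ := ((fun x : ℝ => (x : ℂ)) '' Set.Ici 0)ᶜ

/-- The operator `D^{1/2} (I + (z + 1)(T - z I)⁻¹) D^{1/2} ↾ N`, where `N = Kᗮ`, `D = B₁ - B₀`. -/
def sandwich (K : Submodule ℂ H) (B₀ B₁ : H →L[ℂ] H) (T : H →ₗ.[ℂ] H) (z : ℂ) : Kᗮ →L[ℂ] Kᗮ :=
  compress K (CFC.sqrt (B₁ - B₀) * (1 + (z + 1) • resolvent T z) * CFC.sqrt (B₁ - B₀))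

/-- The function `𝒬̃₀` on `ℂ ∖ ℝ₊`, with values in `L(𝔑)`; here
`S₀ = (I - B₀)(I + B₀)⁻¹`. -/
def Q₀ (B : H →ₗ.[ℂ] H) (B₀ B₁ : H →L[ℂ] H) (z : ℂ) : defect B →L[ℂ] defect B :=
  -1 + ((z + 1) / 2) • sandwich B.domain B₀ B₁ (cayley (ofBounded B₀)) z

/-- The function `𝒬̃₁` on `ℂ ∖ ℝ₊`, with values in `L(𝔑)`; here
`S₁ = (I - B₁)(I + B₁)⁻¹`. -/
def Q₁ (B : H →ₗ.[ℂ] H) (B₀ B₁ : H →L[ℂ] H) (z : ℂ) : defect B →L[ℂ] defect B :=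
  1 + ((z + 1) / 2) • sandwich B.domain B₀ B₁ (cayley (ofBounded B₁)) z

/-- Herglotz-Nevanlinna functions with values in `L(E)`, holomorphic on `ℂ ∖ ℝ₊`.
The values of `M` on `ℝ₊` play no role. -/
structure IsHerglotz {E : Type*} [NormedAddCommGroup E] [InnerProductSpace ℂ E] [CompleteSpace E]
    (M : ℂ → E →L[ℂ] E) : Prop where
  holo : DifferentiableOn ℂ M slit
  symm : ∀ z ∈ slit, M (starRingEnd ℂ z) = ContinuousLinearMap.adjoint (M z)
  im_nonneg : ∀ z : ℂ, 0 < z.im → ∀ g : E, 0 ≤ (inner ℂ g (M z g)).im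

/-- The class `S_F(E)`. For real `x < 0` the number `(M(x) g, g)` is real. -/
structure ClassSF {E : Type*} [NormedAddCommGroup E] [InnerProductSpace ℂ E] [CompleteSpace E]
    (M : ℂ → E →L[ℂ] E) : Prop where
  herglotz : IsHerglotz M
  inv : ∀ z ∈ slit, IsUnit (M z)
  lim_zero : ∀ g : E, Tendsto (fun x : ℝ => M x g) (𝓝[<] 0) (𝓝 0)
  form_lim : ∀ g : E, g ≠ 0 → Tendsto (fun x : ℝ => (inner ℂ g (M x g)).re) atBot atBot
  lim_bot : ∀ g : E, Tendsto (fun x : ℝ => ((x : ℂ)⁻¹) • M x g) atBot (𝓝 0)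

/-- The class `S_K(E)`. For real `x < 0` the number `(M(x) g, g)` is real. -/
structure ClassSK {E : Type*} [NormedAddCommGroup E] [InnerProductSpace ℂ E] [CompleteSpace E]
    (M : ℂ → E →L[ℂ] E) : Prop where
  herglotz : IsHerglotz M
  inv : ∀ z ∈ slit, IsUnit (M z)
  form_zero : ∀ g : E, g ≠ 0 → Tendsto (fun x : ℝ => (inner ℂ g (M x g)).re) (𝓝[<] 0) atTop
  lim_bot : ∀ g : E, Tendsto (fun x : ℝ => M x g) atBot (𝓝 0)
  form_bot : ∀ g : E, g ≠ 0 → Tendsto (fun x : ℝ => x * (inner ℂ g (M x g)).re) atBot atBot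

end

end QFun

namespace QFun

noncomputable section

variable {H : Type*} [NormedAddCommGroup H] [InnerProductSpace ℂ H]

/-! Write `D = B₁ - B₀`, `s = D^{1/2}` and `P_k(z) = (1 - z) I - (1 + z) B_k`. Since `1 + (z +
1)(S_k - z)⁻¹ = 2 P_k(z)⁻¹`, unbounded operators disappear: the two functions are `∓1 + (z + 1) s
P_k(z)⁻¹ s` on `𝔑`. The identity `P₀(z) - P₁(z) = (1 + z) s²` makes their products `-1` and gives
invertibility, and with `k = P(z)⁻¹ s g` the imaginary part of the form is `2 Im z ‖k‖²`.

For real `x`, rescaling turns `P_k(x)` into `D + A + ε` with `ε ↓ 0`: `A = 1 - B₁` for `Q₀` as `x ↑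
0`, and `A = 1 + B₀` for `Q₁` as `x → -∞`. The vanishing limits then say that `s (D + A + ε)⁻¹ s →
1` strongly on `(ker D)ᗮ`, which holds when `ran D^{1/2} ∩ ran A^{1/2} = 0` (`tendsto_sqrt_apply`).
The hypotheses give this with `B₀ - B_μ` and `B_M - B₁` in place of `A`. These are the largest
operators between `0` and `A` vanishing on `dom B`, so their square roots have ranges containing
`ran A^{1/2} ∩ 𝔑` (`mem_range_sqrt_of_mem_orthogonal`).

The limit of `x⁻¹ Q₀(x)` comes from `ker (1 + B₀) = 0`. The divergent forms follow by duality: if `q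
≥ 0` and `q v = g`, then `‖g‖³ ≤ (g, q g) ‖v‖`, where `v` is supplied by the other function and
tends to `0`, after scaling by `x⁻¹` in the last case. -/

/-! ### Resolvents of Cayley transforms through a bounded pencil -/

theorem mem_slit_of_im_ne_zero {z : ℂ} (hz : z.im ≠ 0) : z ∈ slit := by
  rintro ⟨x, -, rfl⟩
  exact hz (Complex.ofReal_im x)

theorem ofReal_mem_slit {x : ℝ} (hx : x < 0) : (x : ℂ) ∈ slit := by
  rintro ⟨y, hy, h⟩
  rw [Complex.ofReal_inj.1 h] at hy
  exact absurd hx (not_lt.2 hy)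

theorem conj_mem_slit {z : ℂ} (hz : z ∈ slit) : starRingEnd ℂ z ∈ slit := by
  rintro ⟨y, hy, h⟩
  refine hz ⟨y, hy, ?_⟩
  have := congrArg (starRingEnd ℂ) h
  simpa using this

/-- The pencil `(1 - z) I - (1 + z) C`, whose inverse yields the resolvent of the Cayley
transform of `C`. -/
def cayleyPencil (C : H →L[ℂ] H) (z : ℂ) : H →L[ℂ] H := (1 - z) • 1 - (1 + z) • C

theorem cayleyPencil_apply (C : H →L[ℂ] H) (z : ℂ) (x : H) :
    cayleyPencil C z x = (1 - z) • x - (1 + z) • C x := by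
  simp [cayleyPencil]

theorem inverse_cayleyPencil_apply {C : H →L[ℂ] H} {z : ℂ} (hu : IsUnit (cayleyPencil C z))
    (x : H) : cayleyPencil C z (Ring.inverse (cayleyPencil C z) x) = x := by
  simpa using congrArg (fun F : H →L[ℂ] H => F x) (Ring.mul_inverse_cancel _ hu)

theorem inverse_apply_cayleyPencil {C : H →L[ℂ] H} {z : ℂ} (hu : IsUnit (cayleyPencil C z))
    (x : H) : Ring.inverse (cayleyPencil C z) (cayleyPencil C z x) = x := by
  simpa using congrArg (fun F : H →L[ℂ] H => F x) (Ring.inverse_mul_cancel _ hu)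

/-- The graph of the transform consists of the pairs `(h + C h, h - C h)`, so applying it minus `z`
to `h + C h` gives `cayleyPencil C z h`. -/
theorem isResolvent_cayley {C : H →L[ℂ] H} (hker : (1 + C).ker = ⊥) {z : ℂ}
    (hu : IsUnit (cayleyPencil C z)) :
    IsResolvent (cayley (ofBounded C)) z ((1 + C) * Ring.inverse (cayleyPencil C z)) := by
  have hT : ∀ f : (ofBounded C).domain, (f : H) + ofBounded C f = 0 → (f : H) = 0 := by
    intro f hf
    have : (f : H) ∈ (1 + C).ker := by
      change (f : H) + C f = 0
      exact hf
    rwa [hker] at this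
  have hg : ∀ h : H, (h + C h, h - C h) ∈ (cayley (ofBounded C)).graph := fun h =>
    (mem_graph_cayley hT).2 ⟨⟨h, trivial⟩, rfl⟩
  have hdom : ∀ h : H, h + C h ∈ (cayley (ofBounded C)).domain := fun h => by
    obtain ⟨y, hy, -⟩ := (LinearPMap.mem_graph_iff _).1 (hg h)
    have hy : (y : H) = h + C h := hy
    exact hy ▸ y.2
  have hval : ∀ (h : H) (p), cayley (ofBounded C) ⟨h + C h, p⟩ = h - C h := fun h p => by
    obtain ⟨y, hy, hy'⟩ := (LinearPMap.mem_graph_iff _).1 (hg h)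
    have : y = ⟨h + C h, p⟩ := Subtype.ext hy
    rw [← this]
    exact hy'
  have hpen : ∀ h : H, h - C h - z • (h + C h) = cayleyPencil C z h := fun h => by
    rw [cayleyPencil_apply]
    module
  refine ⟨fun x => hdom _, fun x => ?_, fun f => ?_⟩
  · refine Eq.trans ?_ (inverse_cayleyPencil_apply hu x)
    rw [← hpen]
    exact congrArg (· - _) (hval _ _)
  · obtain ⟨h, hh⟩ := (mem_graph_cayley hT).1 ((cayley (ofBounded C)).mem_graph f)
    have h1 : (f : H) = h + C h := congrArg Prod.fst hh
    have h2 : cayley (ofBounded C) f = h - C h := congrArg Prod.snd hh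
    rw [h1, h2, hpen]
    change (1 + C) (Ring.inverse (cayleyPencil C z) (cayleyPencil C z h)) = _
    rw [inverse_apply_cayleyPencil hu]
    rfl

theorem one_add_smul_resolvent_cayley {C : H →L[ℂ] H} (hker : (1 + C).ker = ⊥) {z : ℂ}
    (hu : IsUnit (cayleyPencil C z)) :
    1 + (z + 1) • resolvent (cayley (ofBounded C)) z =
      (2 : ℂ) • Ring.inverse (cayleyPencil C z) := by
  rw [(isResolvent_cayley hker hu).resolvent_eq]
  ext x
  have h1 := inverse_cayleyPencil_apply hu x
  rw [cayleyPencil_apply] at h1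
  set k := Ring.inverse (cayleyPencil C z) x
  change x + (z + 1) • (k + C k) = (2 : ℂ) • k
  rw [← h1]
  module

variable [CompleteSpace H]

/-- For `z ≠ -1` the pencil is `(1 + z)(w - C)` with `w = (1 - z)/(1 + z)`. A spectral point `w`
would lie in `[-1, 1]`, and `w = -1` is never attained, so `z = (1 - w)/(1 + w)` would lie in `ℝ₊`.
-/
theorem isUnit_cayleyPencil {C : H →L[ℂ] H} (hC : IsSelfAdjoint C)
    (hn : ‖C‖ ≤ 1) {z : ℂ} (hz : z ∈ slit) : IsUnit (cayleyPencil C z) := by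
  by_cases h1 : 1 + z = 0
  · have : cayleyPencil C z = algebraMap ℂ (H →L[ℂ] H) 2 := by
      rw [cayleyPencil, h1, Algebra.algebraMap_eq_smul_one]
      have : (1 : ℂ) - z = 2 := by linear_combination -h1
      simp [this]
    rw [this]
    exact (IsUnit.mk0 (2 : ℂ) two_ne_zero).map _
  · have hw : (1 - z) / (1 + z) ∉ spectrum ℂ C := by
      intro hw
      have hre := hC.mem_spectrum_eq_re hw
      have hle : ‖(1 - z) / (1 + z)‖ ≤ 1 := by
        have h2 := spectrum.norm_le_norm_mul_of_mem hw
        have h3 : ‖(1 : H →L[ℂ] H)‖ ≤ 1 := ContinuousLinearMap.norm_id_le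
        exact h2.trans (mul_le_one₀ hn (norm_nonneg _) h3)
      set r := ((1 - z) / (1 + z)).re
      rw [hre] at hle
      rw [div_eq_iff h1] at hre
      have hr : (1 + r : ℝ) ≠ 0 := by
        intro h0
        have h4 : (r : ℂ) = -1 := by
          rw [eq_neg_of_add_eq_zero_right h0]; simp
        rw [h4] at hre
        have : (2 : ℂ) = 0 := by linear_combination hre
        exact two_ne_zero this
      have hr' : (1 : ℂ) + r ≠ 0 := by exact_mod_cast hr
      rw [Complex.norm_real, Real.norm_eq_abs, abs_le] at hle
      have hr1 : 0 ≤ 1 + r := by linarith [hle.1]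
      refine hz ⟨(1 - r) / (1 + r), div_nonneg (sub_nonneg.2 hle.2) hr1, ?_⟩
      push_cast
      rw [div_eq_iff hr']
      linear_combination hre
    rw [spectrum.notMem_iff] at hw
    have : cayleyPencil C z = (1 + z) • (algebraMap ℂ (H →L[ℂ] H) ((1 - z) / (1 + z)) - C) := by
      rw [cayleyPencil, Algebra.algebraMap_eq_smul_one, smul_sub, smul_smul, mul_div_cancel₀ _ h1]
    rw [this]
    exact hw.smul (Units.mk0 _ h1)

/-! ### Square roots and their ranges -/

omit [CompleteSpace H] in
theorem re_inner_self_eq (x : H) : (inner ℂ x x).re = ‖x‖ ^ 2 := by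
  simp [← Complex.ofReal_pow]

theorem isSelfAdjoint_sqrt (A : H →L[ℂ] H) : IsSelfAdjoint (CFC.sqrt A) :=
  (CFC.sqrt_nonneg A).isSelfAdjoint

theorem sqrt_apply_sqrt_apply {A : H →L[ℂ] H} (hA : 0 ≤ A) (x : H) :
    CFC.sqrt A (CFC.sqrt A x) = A x := by
  simpa using congrArg (fun F : H →L[ℂ] H => F x) (CFC.sqrt_mul_sqrt_self A hA)

theorem inner_sqrt_left (A : H →L[ℂ] H) (x y : H) :
    inner ℂ (CFC.sqrt A x) y = inner ℂ x (CFC.sqrt A y) :=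
  (isSelfAdjoint_sqrt A).isSymmetric x y

theorem norm_sqrt_apply_sq {A : H →L[ℂ] H} (hA : 0 ≤ A) (x : H) :
    ‖CFC.sqrt A x‖ ^ 2 = (inner ℂ (A x) x).re := by
  rw [← re_inner_self_eq, ← inner_sqrt_left, sqrt_apply_sqrt_apply hA]

theorem sqrt_apply_eq_zero {A : H →L[ℂ] H} (hA : 0 ≤ A) {x : H} (hx : A x = 0) :
    CFC.sqrt A x = 0 := by
  have := norm_sqrt_apply_sq hA x
  rw [hx, inner_zero_left, Complex.zero_re] at this
  exact norm_eq_zero.1 (pow_eq_zero_iff two_ne_zero |>.1 this)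

theorem sqrt_apply_mem_orthogonal_ker {A : H →L[ℂ] H} (hA : 0 ≤ A) (x : H) :
    CFC.sqrt A x ∈ (A.ker)ᗮ := by
  rw [Submodule.mem_orthogonal]
  intro f hf
  rw [← inner_sqrt_left, sqrt_apply_eq_zero hA hf, inner_zero_left]

/-- A form of Douglas' range inclusion lemma for a single vector. -/
theorem mem_range_of_norm_inner_le {R : H →L[ℂ] H} (hR : IsSelfAdjoint R) {y : H} {c : ℝ}
    (hc : ∀ h, ‖inner ℂ y h‖ ≤ c * ‖R h‖) : y ∈ R.range := by
  have hwd : R.ker ≤ LinearMap.ker (innerSL ℂ y).toLinearMap := by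
    intro h hh
    have h0 : R h = 0 := hh
    have := hc h
    rw [h0, norm_zero, mul_zero] at this
    exact norm_le_zero_iff.1 this
  -- The functional `R h ↦ (y, h)` is well defined and bounded on `ran R`. The Riesz vector of a
  -- Hahn–Banach extension is a preimage of `y`, as `R` is selfadjoint.
  obtain ⟨φ, hφ⟩ : ∃ φ : R.range →ₗ[ℂ] ℂ, ∀ h, φ ⟨R h, ⟨h, rfl⟩⟩ = inner ℂ y h := by
    refine ⟨(R.ker.liftQ (innerSL ℂ y).toLinearMap hwd).comp
      (LinearMap.quotKerEquivRange R.toLinearMap).symm.toLinearMap, fun h => ?_⟩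
    have : (LinearMap.quotKerEquivRange R.toLinearMap).symm ⟨R h, ⟨h, rfl⟩⟩ =
        R.ker.mkQ h := by
      rw [LinearEquiv.symm_apply_eq]
      rfl
    simp only [LinearMap.comp_apply, LinearEquiv.coe_coe, this]
    rfl
  have hb : ∀ v : R.range, ‖φ v‖ ≤ c * ‖v‖ := by
    rintro ⟨_, h, rfl⟩
    exact (congrArg norm (hφ h)).trans_le (hc h)
  obtain ⟨g, hg, -⟩ := exists_extension_norm_eq R.range (φ.mkContinuous c hb)
  refine ⟨(InnerProductSpace.toDual ℂ H).symm g, ?_⟩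
  refine ext_inner_right ℂ fun h => ?_
  change inner ℂ (R _) h = _
  have hs : ∀ u v, inner ℂ (R u) v = inner ℂ u (R v) := hR.isSymmetric
  rw [hs, InnerProductSpace.toDual_symm_apply]
  exact (hg ⟨R h, ⟨h, rfl⟩⟩).trans (hφ h)

/-- If `E` dominates every operator `G` with `0 ≤ G ≤ A` and `G ↾ K = 0`, then
`ran A^{1/2} ∩ Kᗮ ⊆ ran E^{1/2}`. -/
theorem mem_range_sqrt_of_mem_orthogonal {A E : H →L[ℂ] H} (hA : 0 ≤ A) (hE : 0 ≤ E)
    {K : Submodule ℂ H} (hmax : ∀ G : H →L[ℂ] H, 0 ≤ G → G ≤ A → (∀ f ∈ K, G f = 0) → G ≤ E)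
    {y : H} (hy : y ∈ (CFC.sqrt A).range) (hyK : y ∈ Kᗮ) : y ∈ (CFC.sqrt E).range := by
  obtain ⟨u, rfl⟩ := hy
  change CFC.sqrt A u ∈ _ at hyK
  change CFC.sqrt A u ∈ _
  set T := CFC.sqrt A with hTdef
  have hT : IsSelfAdjoint T := isSelfAdjoint_sqrt A
  have hTs : ∀ u v, inner ℂ (T u) v = inner ℂ u (T v) := hT.isSymmetric
  let D : Submodule ℂ H := K.map (T : H →ₗ[ℂ] H)
  -- `T P T` is an admissible `G`: the projection `P` kills `T K`. It is the candidate to compare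
  -- with `E`.
  let P : H →L[ℂ] H := Dᗮ.starProjection
  have hP : IsSelfAdjoint P := isSelfAdjoint_starProjection _
  have hPs : ∀ u v, inner ℂ (P u) v = inner ℂ u (P v) := hP.isSymmetric
  have hPP : ∀ x, P (P x) = P x := fun x =>
    Submodule.starProjection_eq_self_iff.2 (Submodule.starProjection_apply_mem _ _)
  have hsa' : IsSelfAdjoint (T * P * T) := by
    have := hP.conjugate T
    rwa [hT.star_eq] at this
  have hform : ∀ x, (inner ℂ ((T * P * T) x) x).re = ‖P (T x)‖ ^ 2 := fun x => by
    have h1 : inner ℂ ((T * P * T) x) x = inner ℂ (P (T x)) (P (T x)) := by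
      change inner ℂ (T (P (T x))) x = _
      rw [hTs, hPs (T x) (P (T x)), hPP, hPs]
    rw [h1, re_inner_self_eq]
  have hGE : T * P * T ≤ E := by
    refine hmax _ ?_ ?_ ?_
    · rw [le_iff_re (IsSelfAdjoint.zero _) hsa']
      intro x
      rw [hform]
      simp
    · rw [le_iff_re hsa' hA.isSelfAdjoint]
      intro x
      rw [hform, ← norm_sqrt_apply_sq hA, ← hTdef]
      have := Submodule.norm_starProjection_apply_le Dᗮ (T x)
      change ‖P (T x)‖ ≤ _ at this
      gcongr
    · intro f hf
      have : P (T f) = 0 := (Submodule.starProjection_apply_eq_zero_iff _).2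
        (Submodule.le_orthogonal_orthogonal _ ⟨f, hf, rfl⟩)
      change T (P (T f)) = 0
      rw [this, map_zero]
  have hPu : P u = u := by
    refine Submodule.starProjection_eq_self_iff.2 ?_
    rw [Submodule.mem_orthogonal]
    rintro _ ⟨f, hf, rfl⟩
    change inner ℂ (T f) u = 0
    rw [hTs]
    exact (Submodule.mem_orthogonal _ _).1 hyK f hf
  -- Since `P u = u`, `(T u, h) = (u, P T h)`, and `‖P T h‖² = (T P T h, h) ≤ ‖E^{1/2} h‖²`.
  refine mem_range_of_norm_inner_le (isSelfAdjoint_sqrt E) (c := ‖u‖) fun h => ?_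
  rw [hTs, ← hPu, hPs, hPu]
  refine (norm_inner_le_norm _ _).trans ?_
  gcongr
  refine le_of_sq_le_sq ?_ (norm_nonneg _)
  rw [← hform, norm_sqrt_apply_sq hE]
  exact (le_iff_re hsa' hE.isSelfAdjoint).1 hGE h

/-! ### Strong limits of regularised inverses -/

/-- `(x, 0)` is a limit of pairs `(D^{1/2} h, A^{1/2} h)` whenever `x ⊥ ker D` and
the ranges of `D^{1/2}` and `A^{1/2}` intersect trivially. -/
theorem exists_sqrt_approx {A D : H →L[ℂ] H} (hD : 0 ≤ D)
    (hdisj : (CFC.sqrt D).range ⊓ (CFC.sqrt A).range = ⊥) {g : H} (hg : g ∈ D.kerᗮ)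
    {δ : ℝ} (hδ : 0 < δ) :
    ∃ h, ‖g - CFC.sqrt D h‖ ^ 2 + ‖CFC.sqrt A h‖ ^ 2 < δ := by
  let W : H →L[ℂ] WithLp 2 (H × H) :=
    (WithLp.prodContinuousLinearEquiv 2 ℂ H H).symm.toContinuousLinearMap ∘L
      (CFC.sqrt D).prod (CFC.sqrt A)
  have hW : ∀ h, W h = WithLp.toLp 2 (CFC.sqrt D h, CFC.sqrt A h) := fun h => rfl
  have hcl : WithLp.toLp 2 (g, (0 : H)) ∈ W.range.topologicalClosure := by
    rw [← Submodule.orthogonal_orthogonal_eq_closure, Submodule.mem_orthogonal]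
    intro p hp
    obtain ⟨u, v⟩ := p
    have hp' : ∀ h, inner ℂ (CFC.sqrt D h) u + inner ℂ (CFC.sqrt A h) v = 0 := fun h => by
      have := (Submodule.mem_orthogonal _ _).1 hp (W h) ⟨h, rfl⟩
      rw [hW] at this
      simpa [WithLp.prod_inner_apply] using this
    have h1 : CFC.sqrt D u + CFC.sqrt A v = 0 := by
      refine ext_inner_left ℂ fun h => ?_
      rw [inner_add_right, inner_zero_right, ← inner_sqrt_left, ← inner_sqrt_left, hp']
    -- For `(u, v)` orthogonal to all the pairs, `D^{1/2} u = -A^{1/2} v` lies in both ranges, hence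
    -- vanishes. So `u ∈ ker D`, which is orthogonal to `g`.
    have h2 : CFC.sqrt D u ∈ (CFC.sqrt D).range ⊓ (CFC.sqrt A).range := by
      refine ⟨⟨u, rfl⟩, ⟨-v, ?_⟩⟩
      change CFC.sqrt A (-v) = _
      rw [map_neg]
      exact (eq_neg_of_add_eq_zero_left h1).symm
    rw [hdisj, Submodule.mem_bot] at h2
    have h3 : D u = 0 := by rw [← sqrt_apply_sqrt_apply hD, h2, map_zero]
    have h4 := (Submodule.mem_orthogonal _ _).1 hg u h3
    simpa [WithLp.prod_inner_apply] using h4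
  obtain ⟨q, ⟨h, rfl⟩, hq⟩ := Metric.mem_closure_iff.1 hcl (Real.sqrt δ) (Real.sqrt_pos.2 hδ)
  refine ⟨h, ?_⟩
  change dist _ (W h) < _ at hq
  rw [hW, dist_eq_norm, Real.lt_sqrt (norm_nonneg _), WithLp.prod_norm_sq_eq_of_L2] at hq
  simpa using hq

/-- The minimum of `‖g - D^{1/2} h‖² + (A h, h) + ε ‖h‖²` is attained at the solution `k` of
`(D + A + ε) k = D^{1/2} g`. -/
theorem norm_sub_sqrt_sq_le {A D : H →L[ℂ] H} (hA : 0 ≤ A) (hD : 0 ≤ D) {g k : H} {ε : ℝ}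
    (hε : 0 ≤ ε) (hk : D k + A k + (ε : ℂ) • k = CFC.sqrt D g) (h : H) :
    ‖g - CFC.sqrt D k‖ ^ 2 ≤ ‖g - CFC.sqrt D h‖ ^ 2 + ‖CFC.sqrt A h‖ ^ 2 + ε * ‖h‖ ^ 2 := by
  obtain ⟨d, rfl⟩ : ∃ d, h = k + d := ⟨h - k, by simp⟩
  have hk2 : CFC.sqrt D (g - CFC.sqrt D k) = A k + (ε : ℂ) • k := by
    rw [map_sub, sqrt_apply_sqrt_apply hD, ← hk]
    abel
  have e1 : g - CFC.sqrt D (k + d) = (g - CFC.sqrt D k) - CFC.sqrt D d := by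
    rw [map_add]; abel
  -- The equation for `k` is the critical point condition: the terms linear in `d` cancel and only
  -- squares remain.
  have e2 : (inner ℂ (g - CFC.sqrt D k) (CFC.sqrt D d)).re =
      (inner ℂ (CFC.sqrt A k) (CFC.sqrt A d)).re + ε * (inner ℂ k d).re := by
    rw [← inner_sqrt_left, hk2, inner_add_left, inner_smul_left, ← inner_sqrt_left,
      sqrt_apply_sqrt_apply hA]
    simp
  have n1 := norm_sub_sq (𝕜 := ℂ) (g - CFC.sqrt D k) (CFC.sqrt D d)
  have n2 := norm_add_sq (𝕜 := ℂ) (CFC.sqrt A k) (CFC.sqrt A d)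
  have n3 := norm_add_sq (𝕜 := ℂ) k d
  simp only [RCLike.re_to_complex] at n1 n2 n3
  rw [e1, map_add, n1, n2, n3, e2]
  have := mul_nonneg hε (sq_nonneg ‖k‖)
  have := mul_nonneg hε (sq_nonneg ‖d‖)
  nlinarith [sq_nonneg ‖CFC.sqrt A k‖, sq_nonneg ‖CFC.sqrt A d‖, sq_nonneg ‖CFC.sqrt D d‖]

/-- Each `k i` minimises the functional of `norm_sub_sqrt_sq_le`. Testing it against one fixed `h`
from `exists_sqrt_approx` leaves only the error `ε i ‖h‖²`, which tends to `0`. -/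
theorem tendsto_sqrt_apply {ι : Type*} {l : Filter ι} {A D : H →L[ℂ] H} (hA : 0 ≤ A) (hD : 0 ≤ D)
    (hdisj : (CFC.sqrt D).range ⊓ (CFC.sqrt A).range = ⊥) {g : H} (hg : g ∈ D.kerᗮ)
    {ε : ι → ℝ} {k : ι → H} (hε0 : ∀ᶠ i in l, 0 ≤ ε i) (hε : Tendsto ε l (𝓝 0))
    (hk : ∀ᶠ i in l, D (k i) + A (k i) + (ε i : ℂ) • k i = CFC.sqrt D g) :
    Tendsto (fun i => CFC.sqrt D (k i)) l (𝓝 g) := by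
  rw [Metric.tendsto_nhds]
  intro δ hδ
  obtain ⟨h, hh⟩ := exists_sqrt_approx hD hdisj hg (pow_pos hδ 2)
  have hlim : Tendsto (fun i => ‖g - CFC.sqrt D h‖ ^ 2 + ‖CFC.sqrt A h‖ ^ 2 + ε i * ‖h‖ ^ 2) l
      (𝓝 (‖g - CFC.sqrt D h‖ ^ 2 + ‖CFC.sqrt A h‖ ^ 2 + 0 * ‖h‖ ^ 2)) :=
    (hε.mul_const _).const_add _
  rw [zero_mul, add_zero] at hlim
  filter_upwards [hε0, hk, hlim.eventually_lt_const hh] with i h1 h2 h3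
  rw [dist_comm, dist_eq_norm]
  exact lt_of_pow_lt_pow_left₀ 2 hδ.le ((norm_sub_sqrt_sq_le hA hD h1 h2 h).trans_lt h3)

/-- `ε (A + ε)⁻¹ → 0` strongly as `ε ↓ 0` if `ker A = 0`. -/
theorem tendsto_smul_of_ker_eq_bot {ι : Type*} {l : Filter ι} {A : H →L[ℂ] H} (hA : 0 ≤ A)
    (hker : A.ker = ⊥) {y : H} {ε : ι → ℝ} {k : ι → H} (hε0 : ∀ᶠ i in l, 0 < ε i)
    (hε : Tendsto ε l (𝓝 0)) (hk : ∀ᶠ i in l, A (k i) + (ε i : ℂ) • k i = y) :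
    Tendsto (fun i => (ε i : ℂ) • k i) l (𝓝 0) := by
  have bound : ∀ {e : ℝ} {u v : H}, 0 < e → A u + (e : ℂ) • u = v → e * ‖u‖ ≤ ‖v‖ := by
    intro e u v he huv
    have h1 : (inner ℂ v u).re = ‖CFC.sqrt A u‖ ^ 2 + e * ‖u‖ ^ 2 := by
      rw [← huv, inner_add_left, inner_smul_left, norm_sqrt_apply_sq hA, ← re_inner_self_eq u]
      simp
    have h2 : (inner ℂ v u).re ≤ ‖v‖ * ‖u‖ :=
      (Complex.re_le_norm _).trans (norm_inner_le_norm _ _)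
    rcases eq_or_lt_of_le (norm_nonneg u) with h0 | h0
    · rw [← h0, mul_zero]
      exact norm_nonneg v
    · refine le_of_mul_le_mul_right ?_ h0
      nlinarith [sq_nonneg ‖CFC.sqrt A u‖]
  -- An injective selfadjoint operator has dense range, so by the uniform bound it suffices to
  -- approximate `y` by some `A h`.
  have hdense : y ∈ A.range.topologicalClosure := by
    rw [← Submodule.orthogonal_orthogonal_eq_closure, Submodule.mem_orthogonal]
    intro u hu
    have hs : ∀ u v, inner ℂ (A u) v = inner ℂ u (A v) := hA.isSelfAdjoint.isSymmetric
    have h0 : A u = 0 := by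
      refine ext_inner_left ℂ fun h => ?_
      rw [inner_zero_right, ← hs]
      exact (Submodule.mem_orthogonal _ _).1 hu _ ⟨h, rfl⟩
    have h1 : u ∈ A.ker := h0
    rw [hker, Submodule.mem_bot] at h1
    rw [h1, inner_zero_left]
  rw [Metric.tendsto_nhds]
  intro δ hδ
  obtain ⟨_, ⟨h, rfl⟩, hh⟩ := Metric.mem_closure_iff.1 hdense (δ / 2) (half_pos hδ)
  change dist y (A h) < _ at hh
  rw [dist_eq_norm] at hh
  have hlim : Tendsto (fun i => δ / 2 + 2 * (ε i * ‖h‖)) l (𝓝 (δ / 2 + 2 * (0 * ‖h‖))) :=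
    ((hε.mul_const _).const_mul _).const_add _
  have hlt : δ / 2 + 2 * (0 * ‖h‖) < δ := by linarith
  filter_upwards [hε0, hk, hlim.eventually_lt_const hlt] with i h1 h2 h3
  rw [dist_zero_right, norm_smul, Complex.norm_real, Real.norm_of_nonneg h1.le]
  have h4 : A (k i - h) + (ε i : ℂ) • (k i - h) = (y - A h) - (ε i : ℂ) • h := by
    rw [← h2, map_sub, smul_sub]
    abel
  have h5 := bound h1 h4
  have h6 : ‖(y - A h) - (ε i : ℂ) • h‖ ≤ ‖y - A h‖ + ε i * ‖h‖ := by
    refine (norm_sub_le _ _).trans_eq ?_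
    rw [norm_smul, Complex.norm_real, Real.norm_of_nonneg h1.le]
  have h7 : ε i * ‖k i‖ ≤ ε i * ‖k i - h‖ + ε i * ‖h‖ := by
    rw [← mul_add]
    have : ‖k i‖ ≤ ‖k i - h‖ + ‖h‖ := by
      simpa using norm_add_le (k i - h) h
    exact mul_le_mul_of_nonneg_left this h1.le
  linarith

/-- A lower bound for the form of a nonnegative operator `q` in terms of a right inverse. -/
theorem pow_norm_le_of_apply_eq {q : H →L[ℂ] H} (hq : 0 ≤ q) {g v : H} (hv : q v = g) :
    ‖g‖ ^ 3 ≤ (inner ℂ g (q g)).re * ‖v‖ := by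
  rcases eq_or_lt_of_le (norm_nonneg g) with h0 | h0
  · rw [← h0, norm_eq_zero.1 h0.symm]
    simp
  set s := CFC.sqrt q
  have h1 : ‖s g‖ ^ 2 = (inner ℂ g (q g)).re := by
    rw [norm_sqrt_apply_sq hq]
    exact inner_re_symm (𝕜 := ℂ) _ _
  have h2 : ‖s v‖ ^ 2 ≤ ‖g‖ * ‖v‖ := by
    rw [norm_sqrt_apply_sq hq, hv]
    exact (Complex.re_le_norm _).trans (norm_inner_le_norm _ _)
  have h3 : ‖g‖ ^ 2 ≤ ‖s g‖ * ‖s v‖ := by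
    rw [← re_inner_self_eq]
    nth_rw 2 [← hv]
    rw [← sqrt_apply_sqrt_apply hq, ← inner_sqrt_left]
    exact (Complex.re_le_norm _).trans (norm_inner_le_norm _ _)
  have h4 : (‖g‖ ^ 2) ^ 2 ≤ (‖s g‖ * ‖s v‖) ^ 2 := by gcongr
  rw [mul_pow, h1] at h4
  have h5 : 0 ≤ (inner ℂ g (q g)).re := by rw [← h1]; positivity
  have h6 := mul_le_mul_of_nonneg_left h2 h5
  refine le_of_mul_le_mul_right ?_ h0
  nlinarith

/-! ### The functions `weylFun`: Herglotz property, products, signs -/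

theorem coe_compress_apply {K : Submodule ℂ H} {T : H →L[ℂ] H} {g : Kᗮ} (h : T g ∈ Kᗮ) :
    (compress K T g : H) = T g := by
  change (Kᗮ.orthogonalProjectionOnto (T g) : H) = T g
  exact Submodule.starProjection_eq_self_iff.2 h

theorem compress_smul (K : Submodule ℂ H) (a : ℂ) (T : H →L[ℂ] H) :
    compress K (a • T) = a • compress K T := by
  ext x
  simp [compress]

/-- The function `c I + (z + 1) s ((1 - z) I - (1 + z) C)⁻¹ s ↾ Kᗮ`. -/
def weylFun (K : Submodule ℂ H) (s C : H →L[ℂ] H) (c : ℝ) (z : ℂ) : Kᗮ →L[ℂ] Kᗮ :=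
  (c : ℂ) • 1 + (z + 1) • compress K (s * Ring.inverse (cayleyPencil C z) * s)

theorem coe_weylFun_apply {K : Submodule ℂ H} {s : H →L[ℂ] H} (hs : ∀ x, s x ∈ Kᗮ)
    (C : H →L[ℂ] H) (c : ℝ) (z : ℂ) (g : Kᗮ) :
    (weylFun K s C c z g : H) =
      (c : ℂ) • (g : H) + (z + 1) • s (Ring.inverse (cayleyPencil C z) (s g)) := by
  have : (compress K (s * Ring.inverse (cayleyPencil C z) * s) g : H) =
      s (Ring.inverse (cayleyPencil C z) (s g)) := coe_compress_apply (hs _)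
  rw [← this]
  rfl

theorem half_smul_sandwich {C B₀ B₁ : H →L[ℂ] H} {K : Submodule ℂ H} (hker : (1 + C).ker = ⊥)
    {z : ℂ} (hu : IsUnit (cayleyPencil C z)) :
    ((z + 1) / 2) • sandwich K B₀ B₁ (cayley (ofBounded C)) z =
      (z + 1) • compress K (CFC.sqrt (B₁ - B₀) * Ring.inverse (cayleyPencil C z) *
        CFC.sqrt (B₁ - B₀)) := by
  rw [sandwich, one_add_smul_resolvent_cayley hker hu, mul_smul_comm, smul_mul_assoc,
    compress_smul, smul_smul, div_mul_cancel₀ _ two_ne_zero]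

theorem inner_cayleyPencil_left {C : H →L[ℂ] H} (hC : IsSelfAdjoint C) (z : ℂ) (x y : H) :
    inner ℂ (cayleyPencil C (starRingEnd ℂ z) x) y = inner ℂ x (cayleyPencil C z y) := by
  have hs : inner ℂ (C x) y = inner ℂ x (C y) := hC.isSymmetric x y
  simp only [cayleyPencil_apply, inner_sub_left, inner_sub_right, inner_smul_left,
    inner_smul_right, hs, map_sub, map_add, map_one, Complex.conj_conj]

theorem isHerglotz_weylFun {K : Submodule ℂ H} {s C : H →L[ℂ] H} (hs : ∀ x, s x ∈ Kᗮ)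
    (hsa : IsSelfAdjoint s) (hC : IsSelfAdjoint C) (hn : ‖C‖ ≤ 1) (c : ℝ) :
    IsHerglotz (weylFun K s C c) := by
  have hss : ∀ u v, inner ℂ (s u) v = inner ℂ u (s v) := hsa.isSymmetric
  refine ⟨fun z hz => DifferentiableAt.differentiableWithinAt ?_, fun z hz => ?_,
    fun z hz g => ?_⟩
  · have h1 : DifferentiableAt ℂ (fun z => cayleyPencil C z) z := by
      unfold cayleyPencil
      fun_prop
    have h2 : DifferentiableAt ℂ (fun z => Ring.inverse (cayleyPencil C z)) z :=
      (differentiableAt_inverse (isUnit_cayleyPencil hC hn hz)).comp z h1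
    have h3 : DifferentiableAt ℂ
        (fun z => compress K (s * Ring.inverse (cayleyPencil C z) * s)) z := by
      have h4 := (h2.const_mul s).mul_const s
      unfold compress
      exact (differentiableAt_const _).clm_comp (h4.clm_comp (differentiableAt_const _))
    unfold weylFun
    exact (differentiableAt_const _).add
      ((differentiableAt_fun_id.add_const (1 : ℂ)).smul h3)
  · rw [ContinuousLinearMap.eq_adjoint_iff]
    intro x y
    rw [Submodule.coe_inner, Submodule.coe_inner, coe_weylFun_apply hs, coe_weylFun_apply hs]
    simp only [inner_add_left, inner_add_right, inner_smul_left, inner_smul_right, map_add,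
      map_one, Complex.conj_conj, Complex.conj_ofReal]
    rw [hss, ← hss (x : H)]
    have hx := inverse_cayleyPencil_apply (isUnit_cayleyPencil hC hn (conj_mem_slit hz)) (s x)
    have hy := inverse_cayleyPencil_apply (isUnit_cayleyPencil hC hn hz) (s y)
    nth_rw 2 [← hx]
    nth_rw 1 [← hy]
    rw [inner_cayleyPencil_left hC]
  · rw [Submodule.coe_inner, coe_weylFun_apply hs, inner_add_right, inner_smul_right,
      inner_smul_right, ← hss]
    have hu := isUnit_cayleyPencil hC hn (mem_slit_of_im_ne_zero hz.ne')
    have hk := inverse_cayleyPencil_apply hu (s g)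
    set k := Ring.inverse (cayleyPencil C z) (s g)
    rw [← hk, cayleyPencil_apply, inner_sub_left, inner_smul_left, inner_smul_left]
    have h1 : (inner ℂ (g : H) (g : H)).im = 0 := inner_self_im (𝕜 := ℂ) _
    have h2 : (inner ℂ k k).im = 0 := inner_self_im (𝕜 := ℂ) _
    have h3 : (inner ℂ (C k) k).im = 0 := hC.isSymmetric.im_inner_apply_self k
    have h4 := re_inner_self_eq k
    simp only [Complex.add_im, Complex.mul_im, Complex.mul_re, Complex.sub_re, Complex.sub_im,
      Complex.add_re, Complex.ofReal_re, Complex.ofReal_im, map_sub, map_add, map_one,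
      Complex.conj_re, Complex.conj_im, Complex.one_re, Complex.one_im, h1, h2, h3, h4]
    nlinarith [mul_nonneg hz.le (sq_nonneg ‖k‖)]

theorem IsHerglotz.congr {E : Type*} [NormedAddCommGroup E] [InnerProductSpace ℂ E]
    [CompleteSpace E] {M M' : ℂ → E →L[ℂ] E} (h : IsHerglotz M) (hM : ∀ z ∈ slit, M' z = M z) :
    IsHerglotz M' where
  holo := h.holo.congr hM
  symm z hz := by rw [hM _ (conj_mem_slit hz), hM z hz, h.symm z hz]
  im_nonneg z hz g := by
    rw [hM z (mem_slit_of_im_ne_zero hz.ne')]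
    exact h.im_nonneg z hz g

theorem IsHerglotz.isSelfAdjoint {E : Type*} [NormedAddCommGroup E] [InnerProductSpace ℂ E]
    [CompleteSpace E] {M : ℂ → E →L[ℂ] E} (h : IsHerglotz M) {x : ℝ} (hx : x < 0) :
    IsSelfAdjoint (M x) := by
  have := h.symm x (ofReal_mem_slit hx)
  rw [Complex.conj_ofReal] at this
  exact this.symm

/-- With `k = P₁(z)⁻¹ s g`, the relation `P₀(z) = P₁(z) + (1 + z) s²` gives `s (g + (z + 1) s k) =
P₀(z) k`, so the inverse in the outer factor just returns `k`. -/
theorem weylFun_neg_one_mul_weylFun_one {K : Submodule ℂ H} {s C₀ C₁ : H →L[ℂ] H}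
    (hs : ∀ x, s x ∈ Kᗮ) (hss : ∀ x, s (s x) = C₁ x - C₀ x) {z : ℂ}
    (h₀ : IsUnit (cayleyPencil C₀ z)) (h₁ : IsUnit (cayleyPencil C₁ z)) :
    weylFun K s C₀ (-1) z * weylFun K s C₁ 1 z = -1 := by
  ext g
  change (weylFun K s C₀ (-1) z (weylFun K s C₁ 1 z g) : H) = -(g : H)
  have hk := inverse_cayleyPencil_apply h₁ (s g)
  rw [coe_weylFun_apply hs, coe_weylFun_apply hs]
  set k := Ring.inverse (cayleyPencil C₁ z) (s g)
  have : s (((1 : ℝ) : ℂ) • (g : H) + (z + 1) • s k) = cayleyPencil C₀ z k := by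
    rw [map_add, map_smul, map_smul, ← hk, hss, cayleyPencil_apply, cayleyPencil_apply]
    push_cast
    module
  rw [this, inverse_apply_cayleyPencil h₀]
  push_cast
  module

theorem weylFun_one_mul_weylFun_neg_one {K : Submodule ℂ H} {s C₀ C₁ : H →L[ℂ] H}
    (hs : ∀ x, s x ∈ Kᗮ) (hss : ∀ x, s (s x) = C₁ x - C₀ x) {z : ℂ}
    (h₀ : IsUnit (cayleyPencil C₀ z)) (h₁ : IsUnit (cayleyPencil C₁ z)) :
    weylFun K s C₁ 1 z * weylFun K s C₀ (-1) z = -1 := by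
  ext g
  change (weylFun K s C₁ 1 z (weylFun K s C₀ (-1) z g) : H) = -(g : H)
  have hk := inverse_cayleyPencil_apply h₀ (s g)
  rw [coe_weylFun_apply hs, coe_weylFun_apply hs]
  set k := Ring.inverse (cayleyPencil C₀ z) (s g)
  have : s (((-1 : ℝ) : ℂ) • (g : H) + (z + 1) • s k) = cayleyPencil C₁ z (-k) := by
    rw [map_add, map_smul, map_smul, ← hk, hss, map_neg, cayleyPencil_apply, cayleyPencil_apply]
    push_cast
    module
  rw [this, inverse_apply_cayleyPencil h₁, map_neg]
  push_cast
  module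

theorem re_inner_weylFun {K : Submodule ℂ H} {s C : H →L[ℂ] H} (hs : ∀ x, s x ∈ Kᗮ)
    (hsa : IsSelfAdjoint s) (c : ℝ) {x : ℝ} (hu : IsUnit (cayleyPencil C x)) (g : Kᗮ) :
    ∃ k : H, (inner ℂ (weylFun K s C c x g) g).re =
      c * ‖g‖ ^ 2 + (x + 1) * ((1 - x) * ‖k‖ ^ 2 - (1 + x) * (inner ℂ (C k) k).re) := by
  have hss : ∀ u v, inner ℂ (s u) v = inner ℂ u (s v) := hsa.isSymmetric
  have hk := inverse_cayleyPencil_apply hu (s g)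
  refine ⟨Ring.inverse (cayleyPencil C x) (s g), ?_⟩
  rw [Submodule.coe_inner, coe_weylFun_apply hs, inner_add_left, inner_smul_left, inner_smul_left,
    hss]
  set k := Ring.inverse (cayleyPencil C x) (s g)
  have h1 : inner ℂ (k : H) (C k) = starRingEnd ℂ (inner ℂ (C k) k) := (inner_conj_symm _ _).symm
  have h2 : (inner ℂ (k : H) (k : H)).im = 0 := inner_self_im (𝕜 := ℂ) _
  have h3 : ‖g‖ = ‖(g : H)‖ := rfl
  rw [← hk, cayleyPencil_apply, inner_sub_right, inner_smul_right, inner_smul_right, h1,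
    h3, ← re_inner_self_eq k, ← re_inner_self_eq (g : H)]
  simp only [Complex.add_re, Complex.add_im, Complex.sub_re, Complex.sub_im, Complex.mul_re,
    Complex.mul_im, Complex.conj_re, Complex.conj_im, Complex.one_re, Complex.one_im,
    Complex.ofReal_re, Complex.ofReal_im, map_add, map_one, Complex.conj_ofReal, h2]
  ring

omit [CompleteSpace H] in
theorem abs_re_inner_le_of_norm_le_one {C : H →L[ℂ] H} (hn : ‖C‖ ≤ 1) (k : H) :
    |(inner ℂ (C k) k).re| ≤ ‖k‖ ^ 2 := by
  refine (Complex.abs_re_le_norm _).trans ((norm_inner_le_norm _ _).trans ?_)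
  have := C.le_of_opNorm_le hn k
  nlinarith [norm_nonneg k]

theorem weylFun_one_nonneg {K : Submodule ℂ H} {s C : H →L[ℂ] H} (hs : ∀ x, s x ∈ Kᗮ)
    (hsa : IsSelfAdjoint s) (hC : IsSelfAdjoint C) (hn : ‖C‖ ≤ 1) {x : ℝ} (hx : -1 < x)
    (hx0 : x < 0) : 0 ≤ weylFun K s C 1 x := by
  rw [le_iff_re (IsSelfAdjoint.zero _) ((isHerglotz_weylFun hs hsa hC hn 1).isSelfAdjoint hx0)]
  intro g
  obtain ⟨k, hk⟩ := re_inner_weylFun hs hsa 1 (isUnit_cayleyPencil hC hn (ofReal_mem_slit hx0)) g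
  rw [hk, zero_apply, inner_zero_left, Complex.zero_re]
  have h1 := (abs_le.1 (abs_re_inner_le_of_norm_le_one hn k)).2
  have h2 := mul_le_mul_of_nonneg_left h1 (by linarith : 0 ≤ 1 + x)
  have h3 : 0 ≤ (1 - x) * ‖k‖ ^ 2 - (1 + x) * (inner ℂ (C k) k).re := by
    nlinarith [mul_nonneg (neg_nonneg.2 hx0.le) (sq_nonneg ‖k‖)]
  nlinarith [mul_nonneg (by linarith : 0 ≤ x + 1) h3, sq_nonneg ‖g‖]

theorem neg_weylFun_neg_one_nonneg {K : Submodule ℂ H} {s C : H →L[ℂ] H} (hs : ∀ x, s x ∈ Kᗮ)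
    (hsa : IsSelfAdjoint s) (hC : IsSelfAdjoint C) (hn : ‖C‖ ≤ 1) {x : ℝ} (hx : x < -1) :
    0 ≤ -weylFun K s C (-1) x := by
  have hx0 : x < 0 := by linarith
  rw [le_iff_re (IsSelfAdjoint.zero _)
    ((isHerglotz_weylFun hs hsa hC hn (-1)).isSelfAdjoint hx0).neg]
  intro g
  obtain ⟨k, hk⟩ :=
    re_inner_weylFun hs hsa (-1) (isUnit_cayleyPencil hC hn (ofReal_mem_slit hx0)) g
  rw [neg_apply, inner_neg_left, Complex.neg_re, hk, zero_apply,
    inner_zero_left, Complex.zero_re]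
  have h1 := (abs_le.1 (abs_re_inner_le_of_norm_le_one hn k)).1
  have h2 := mul_le_mul_of_nonneg_left h1 (by linarith : 0 ≤ -(1 + x))
  have h3 : 0 ≤ (1 - x) * ‖k‖ ^ 2 - (1 + x) * (inner ℂ (C k) k).re := by
    nlinarith [sq_nonneg ‖k‖]
  nlinarith [mul_nonneg (by linarith : 0 ≤ -(x + 1)) h3, sq_nonneg ‖g‖]

/-- The form of `q` at `g` is that of `-p` at `q g`. -/
theorem nonneg_of_neg_mul_eq_neg_one {p q : H →L[ℂ] H} (hp : 0 ≤ -p) (hq : IsSelfAdjoint q)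
    (hpq : p * q = -1) : 0 ≤ q := by
  rw [le_iff_re (IsSelfAdjoint.zero _) hq]
  intro g
  have h1 := (le_iff_re (IsSelfAdjoint.zero _) hp.isSelfAdjoint).1 hp (q g)
  have h2 : p (q g) = -g := congrArg (fun F : H →L[ℂ] H => F g) hpq
  rw [neg_apply, h2, neg_neg] at h1
  refine h1.trans_eq ?_ |>.trans_eq' ?_
  · exact inner_re_symm (𝕜 := ℂ) _ _
  · simp

theorem tendsto_atTop_of_le_mul {ι : Type*} {l : Filter ι} {f r : ι → ℝ} {c : ℝ} (hc : 0 < c)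
    (hr0 : ∀ i, 0 ≤ r i) (hr : Tendsto r l (𝓝 0)) (hf : ∀ᶠ i in l, c ≤ f i * r i) :
    Tendsto f l atTop := by
  have hpos : ∀ᶠ i in l, 0 < r i := by
    filter_upwards [hf] with i hi
    refine (hr0 i).lt_of_ne fun h => ?_
    rw [← h, mul_zero] at hi
    exact absurd hc (not_lt.2 hi)
  have h1 : Tendsto (fun i => c * (r i)⁻¹) l atTop :=
    (tendsto_inv_nhdsGT_zero.comp (tendsto_nhdsWithin_iff.2 ⟨hr, hpos⟩)).const_mul_atTop hc
  refine tendsto_atTop_mono' l ?_ h1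
  filter_upwards [hf, hpos] with i h2 h3
  rw [← div_eq_mul_inv, div_le_iff₀ h3]
  exact h2

/-! ### Limits at `0` and at `-∞` -/

theorem tendsto_neg_two_div_atBot :
    Tendsto (fun x : ℝ => -2 / (1 + x)) atBot (𝓝 0) :=
  (tendsto_const_nhds (x := (-2 : ℝ))).div_atBot (tendsto_atBot_add_const_left _ 1 tendsto_id)

/-- For `-1 < x < 0`, `(1 - x)/(1 + x) = 1 + ε` with `ε = -2x/(1 + x)`. So `k = (x + 1) P(x)⁻¹
D^{1/2} g` solves `(D + A + ε) k = D^{1/2} g` with `A = 1 - (C + D)`, and the function at `g` is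
`D^{1/2} k - g`. -/
theorem tendsto_weylFun_neg_one_zero {K : Submodule ℂ H} {C D : H →L[ℂ] H} (hD : 0 ≤ D)
    (hK : D.ker = K) (hC : IsSelfAdjoint C) (hn : ‖C‖ ≤ 1) (hA : 0 ≤ 1 - (C + D))
    (hdisj : (CFC.sqrt D).range ⊓ (CFC.sqrt (1 - (C + D))).range = ⊥) (g : Kᗮ) :
    Tendsto (fun x : ℝ => weylFun K (CFC.sqrt D) C (-1) x g) (𝓝[<] 0) (𝓝 0) := by
  subst hK
  have hs := sqrt_apply_mem_orthogonal_ker hD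
  have hmem : Set.Ioo (-1 : ℝ) 0 ∈ 𝓝[<] (0 : ℝ) := Ioo_mem_nhdsLT (by norm_num)
  have hε : Tendsto (fun x : ℝ => -2 * x / (1 + x)) (𝓝[<] 0) (𝓝 0) := by
    have : ContinuousAt (fun x : ℝ => -2 * x / (1 + x)) 0 := by
      apply ContinuousAt.div <;> first | fun_prop | norm_num
    simpa using this.tendsto.mono_left nhdsWithin_le_nhds
  rw [tendsto_subtype_rng]
  have key := tendsto_sqrt_apply hA hD hdisj g.2
    (k := fun x : ℝ => ((x : ℂ) + 1) • Ring.inverse (cayleyPencil C x) (CFC.sqrt D g))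
    (by
      filter_upwards [hmem] with x hx
      exact div_nonneg (by linarith [hx.2]) (by linarith [hx.1])) hε
    (by
      filter_upwards [hmem] with x hx
      have hk := inverse_cayleyPencil_apply (isUnit_cayleyPencil hC hn (ofReal_mem_slit hx.2))
        (CFC.sqrt D g)
      set k := Ring.inverse (cayleyPencil C x) (CFC.sqrt D g)
      have h1 : (1 + x : ℂ) ≠ 0 := by
        have : (1 + x : ℝ) ≠ 0 := by linarith [hx.1]
        exact_mod_cast this
      have h2 : (((-2 * x / (1 + x) : ℝ) : ℂ)) * (x + 1) = -2 * x := by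
        push_cast
        field_simp
        ring
      rw [← hk, cayleyPencil_apply, smul_smul, h2]
      simp only [map_smul, sub_apply, add_apply, one_apply_eq_self]
      module)
  have := (key.sub_const (g : H))
  rw [sub_self] at this
  refine this.congr fun x => ?_
  rw [coe_weylFun_apply hs, map_smul]
  push_cast
  module

/-- For `x < -1` the pencil is `-(1 + x)(1 + C + ε)` with `ε = -2/(1 + x)`, and `1 + C = D + A` with
`A = 1 + (C - D)`. The function at `g` is now `g - D^{1/2} k`. -/
theorem tendsto_weylFun_one_atBot {K : Submodule ℂ H} {C D : H →L[ℂ] H} (hD : 0 ≤ D)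
    (hK : D.ker = K) (hC : IsSelfAdjoint C) (hn : ‖C‖ ≤ 1) (hA : 0 ≤ 1 + (C - D))
    (hdisj : (CFC.sqrt D).range ⊓ (CFC.sqrt (1 + (C - D))).range = ⊥) (g : Kᗮ) :
    Tendsto (fun x : ℝ => weylFun K (CFC.sqrt D) C 1 x g) atBot (𝓝 0) := by
  subst hK
  have hs := sqrt_apply_mem_orthogonal_ker hD
  rw [tendsto_subtype_rng]
  have key := tendsto_sqrt_apply hA hD hdisj g.2
    (k := fun x : ℝ => -((x : ℂ) + 1) • Ring.inverse (cayleyPencil C x) (CFC.sqrt D g))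
    (by
      filter_upwards [eventually_lt_atBot (-1 : ℝ)] with x hx
      exact div_nonneg_of_nonpos (by norm_num) (by linarith)) tendsto_neg_two_div_atBot
    (by
      filter_upwards [eventually_lt_atBot (-1 : ℝ)] with x hx
      have hk := inverse_cayleyPencil_apply
        (isUnit_cayleyPencil hC hn (ofReal_mem_slit (by linarith : x < 0))) (CFC.sqrt D g)
      set k := Ring.inverse (cayleyPencil C x) (CFC.sqrt D g)
      have h1 : (1 + x : ℂ) ≠ 0 := by
        have : (1 + x : ℝ) ≠ 0 := by linarith
        exact_mod_cast this
      have h2 : (((-2 / (1 + x) : ℝ) : ℂ)) * -(x + 1) = 2 := by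
        push_cast
        field_simp
        ring
      rw [← hk, cayleyPencil_apply, smul_smul, h2]
      simp only [map_smul, sub_apply, add_apply, one_apply_eq_self]
      module)
  have := (key.const_sub (g : H))
  rw [sub_self] at this
  refine this.congr fun x => ?_
  rw [coe_weylFun_apply hs, map_smul]
  push_cast
  module

theorem tendsto_inv_smul_weylFun_atBot {K : Submodule ℂ H} {s C : H →L[ℂ] H}
    (hs : ∀ x, s x ∈ Kᗮ) (hC : IsSelfAdjoint C) (hn : ‖C‖ ≤ 1) (hA : 0 ≤ 1 + C)
    (hker : (1 + C).ker = ⊥) (c : ℝ) (g : Kᗮ) :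
    Tendsto (fun x : ℝ => (x : ℂ)⁻¹ • weylFun K s C c x g) atBot (𝓝 0) := by
  rw [tendsto_subtype_rng]
  have key := tendsto_smul_of_ker_eq_bot hA hker (y := s g)
    (k := fun x : ℝ => -((x : ℂ) + 1) • Ring.inverse (cayleyPencil C x) (s g))
    (by
      filter_upwards [eventually_lt_atBot (-1 : ℝ)] with x hx
      exact div_pos_of_neg_of_neg (by norm_num) (by linarith)) tendsto_neg_two_div_atBot
    (by
      filter_upwards [eventually_lt_atBot (-1 : ℝ)] with x hx
      have hk := inverse_cayleyPencil_apply
        (isUnit_cayleyPencil hC hn (ofReal_mem_slit (by linarith : x < 0))) (s g)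
      set k := Ring.inverse (cayleyPencil C x) (s g)
      have h1 : (1 + x : ℂ) ≠ 0 := by
        have : (1 + x : ℝ) ≠ 0 := by linarith
        exact_mod_cast this
      have h2 : (((-2 / (1 + x) : ℝ) : ℂ)) * -(x + 1) = 2 := by
        push_cast
        field_simp
        ring
      rw [← hk, cayleyPencil_apply, smul_smul, h2]
      simp only [map_smul, add_apply, one_apply_eq_self]
      module)
  have hinv : Tendsto (fun x : ℝ => (x : ℂ)⁻¹) atBot (𝓝 0) := by
    have := (Complex.continuous_ofReal.tendsto 0).comp tendsto_inv_atBot_zero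
    simpa [Function.comp_def] using this
  have h1 : Tendsto (fun x : ℝ => (x : ℂ)⁻¹ * c) atBot (𝓝 (0 * c)) := hinv.mul_const _
  -- Here `ε k = 2 P(x)⁻¹ s g`, which accounts for the factor `1/2`.
  have h2 : Tendsto (fun x : ℝ => ((x : ℂ)⁻¹ + 1) * (1 / 2)) atBot (𝓝 ((0 + 1) * (1 / 2))) :=
    (hinv.add_const _).mul_const _
  have h3 := (h1.smul_const (g : H)).add (h2.smul ((s.continuous.tendsto _).comp key))
  rw [zero_mul, zero_smul, map_zero, smul_zero, add_zero] at h3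
  refine h3.congr' ?_
  filter_upwards [eventually_lt_atBot (-1 : ℝ)] with x hx
  have h4 : (1 + x : ℂ) ≠ 0 := by
    have : (1 + x : ℝ) ≠ 0 := by linarith
    exact_mod_cast this
  have h5 : (x : ℂ) ≠ 0 := by
    have : x ≠ 0 := by linarith
    exact_mod_cast this
  change _ = (x : ℂ)⁻¹ • (weylFun _ _ C c x g : H)
  rw [coe_weylFun_apply hs, Function.comp_apply, map_smul, map_smul, smul_add]
  simp only [smul_smul]
  congr 2
  push_cast
  field_simp

/-! ### Transfer of the range conditions to `1 + B₀` and `1 - B₁` -/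

theorem sqrt_range_inf_range_eq_bot {D A E : H →L[ℂ] H} (hD : 0 ≤ D) (hA : 0 ≤ A) (hE : 0 ≤ E)
    (hmax : ∀ G : H →L[ℂ] H, 0 ≤ G → G ≤ A → (∀ f ∈ D.ker, G f = 0) → G ≤ E)
    (h : (CFC.sqrt D).range ⊓ (CFC.sqrt E).range = ⊥) :
    (CFC.sqrt D).range ⊓ (CFC.sqrt A).range = ⊥ := by
  rw [eq_bot_iff]
  rintro y ⟨h1, h2⟩
  rw [← h]
  refine ⟨h1, mem_range_sqrt_of_mem_orthogonal hA hE hmax h2 ?_⟩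
  obtain ⟨u, rfl⟩ := h1
  exact sqrt_apply_mem_orthogonal_ker hD u

/-- If `0 ≤ G ≤ 1 + B₀` and `G` vanishes on `dom B`, then `B₀ - G` is again an `sc`-extension.
Minimality of `B_μ` yields `G ≤ B₀ - B_μ`. -/
theorem IsSpecialPair.range_inf_range_one_add {B : H →ₗ.[ℂ] H} {B₀ B₁ : H →L[ℂ] H}
    (h : IsSpecialPair B B₀ B₁) :
    (CFC.sqrt (B₁ - B₀)).range ⊓ (CFC.sqrt (1 + B₀)).range = ⊥ := by
  obtain ⟨hsa, ⟨hl, hu⟩, hext⟩ := mem_scExt_iff.1 h.sc₀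
  have hmin := isLeast_extMin ⟨B₀, h.sc₀⟩
  refine sqrt_range_inf_range_eq_bot (sub_nonneg.2 h.le) (neg_le_iff_add_nonneg'.1 hl)
    (sub_nonneg.2 (hmin.2 h.sc₀)) (fun G hG hGA hGK => ?_) h.range_min
  rw [h.ker_eq] at hGK
  rw [le_sub_comm]
  refine hmin.2 (mem_scExt_iff.2 ⟨hsa.sub hG.isSelfAdjoint, ⟨?_, ?_⟩, fun f => ?_⟩)
  · rw [neg_le_sub_iff_le_add, add_comm]
    exact hGA
  · exact (sub_le_self _ hG).trans hu
  · rw [sub_apply, hGK f f.2, sub_zero, hext]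

theorem IsSpecialPair.range_inf_range_one_sub {B : H →ₗ.[ℂ] H} {B₀ B₁ : H →L[ℂ] H}
    (h : IsSpecialPair B B₀ B₁) :
    (CFC.sqrt (B₁ - B₀)).range ⊓ (CFC.sqrt (1 - B₁)).range = ⊥ := by
  obtain ⟨hsa, ⟨hl, hu⟩, hext⟩ := mem_scExt_iff.1 h.sc₁
  have hmax := isGreatest_extMax ⟨B₁, h.sc₁⟩
  refine sqrt_range_inf_range_eq_bot (sub_nonneg.2 h.le) (sub_nonneg.2 hu)
    (sub_nonneg.2 (hmax.2 h.sc₁)) (fun G hG hGA hGK => ?_) h.range_max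
  rw [h.ker_eq] at hGK
  rw [le_sub_iff_add_le']
  refine hmax.2 (mem_scExt_iff.2 ⟨hsa.add hG.isSelfAdjoint, ⟨?_, ?_⟩, fun f => ?_⟩)
  · exact hl.trans (le_add_of_nonneg_right hG)
  · exact le_sub_iff_add_le'.1 hGA
  · rw [add_apply, hGK f f.2, add_zero, hext]

end

end QFun

/-! ### The main theorem -/

theorem theorem6p3 {H : Type*} [NormedAddCommGroup H] [InnerProductSpace ℂ H] [CompleteSpace H]
    (S : H →ₗ.[ℂ] H) (hS : QFun.IsNonnegSymmetric S) (hclosed : S.IsClosed)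
    (B : H →ₗ.[ℂ] H) (hB : B = QFun.cayley S)
    (B₀ B₁ : H →L[ℂ] H) (hpair : QFun.IsSpecialPair B B₀ B₁)
    -- the extensions `S_k = (I - B_k)(I + B_k)⁻¹` of `S` are operators
    (hker₀ : (1 + B₀).ker = ⊥) (hker₁ : (1 + B₁).ker = ⊥) :
    QFun.ClassSF (QFun.Q₀ B B₀ B₁) ∧ QFun.ClassSK (QFun.Q₁ B B₀ B₁) ∧
      ∀ z ∈ QFun.slit,
        QFun.Q₀ B B₀ B₁ z * QFun.Q₁ B B₀ B₁ z = -1 ∧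
        QFun.Q₁ B B₀ B₁ z * QFun.Q₀ B B₀ B₁ z = -1 := by
  open QFun in
  obtain ⟨hsa₀, ⟨hl₀, hu₀⟩, -⟩ := mem_scExt_iff.1 hpair.sc₀
  obtain ⟨hsa₁, ⟨hl₁, hu₁⟩, -⟩ := mem_scExt_iff.1 hpair.sc₁
  have hn₀ := hpair.sc₀.2.1
  have hn₁ := hpair.sc₁.2.1
  have hD : 0 ≤ B₁ - B₀ := sub_nonneg.2 hpair.le
  have hs : ∀ x, CFC.sqrt (B₁ - B₀) x ∈ B.domainᗮ := fun x => by
    rw [← hpair.ker_eq]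
    exact sqrt_apply_mem_orthogonal_ker hD x
  have hsa := isSelfAdjoint_sqrt (B₁ - B₀)
  have hss : ∀ x, CFC.sqrt (B₁ - B₀) (CFC.sqrt (B₁ - B₀) x) = B₁ x - B₀ x := fun x =>
    sqrt_apply_sqrt_apply hD x
  have e₀ : ∀ z ∈ slit, Q₀ B B₀ B₁ z = weylFun B.domain (CFC.sqrt (B₁ - B₀)) B₀ (-1) z :=
    fun z hz => by
      rw [Q₀, half_smul_sandwich hker₀ (isUnit_cayleyPencil hsa₀ hn₀ hz), weylFun]
      congr 1
      ext g
      simp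
  have e₁ : ∀ z ∈ slit, Q₁ B B₀ B₁ z = weylFun B.domain (CFC.sqrt (B₁ - B₀)) B₁ 1 z :=
    fun z hz => by
      rw [Q₁, half_smul_sandwich hker₁ (isUnit_cayleyPencil hsa₁ hn₁ hz), weylFun,
        Complex.ofReal_one, one_smul]
  have hmul : ∀ z ∈ slit, Q₀ B B₀ B₁ z * Q₁ B B₀ B₁ z = -1 ∧
      Q₁ B B₀ B₁ z * Q₀ B B₀ B₁ z = -1 := fun z hz => by
    rw [e₀ z hz, e₁ z hz]
    have h₀ := isUnit_cayleyPencil hsa₀ hn₀ hz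
    have h₁ := isUnit_cayleyPencil hsa₁ hn₁ hz
    exact ⟨weylFun_neg_one_mul_weylFun_one hs hss h₀ h₁,
      weylFun_one_mul_weylFun_neg_one hs hss h₀ h₁⟩
  have hz₀ : IsHerglotz (Q₀ B B₀ B₁) := (isHerglotz_weylFun hs hsa hsa₀ hn₀ (-1)).congr e₀
  have hz₁ : IsHerglotz (Q₁ B B₀ B₁) := (isHerglotz_weylFun hs hsa hsa₁ hn₁ 1).congr e₁
  have hmul₀ : ∀ x : ℝ, x < 0 → ∀ g, Q₀ B B₀ B₁ x (Q₁ B B₀ B₁ x g) = -g := fun x hx g =>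
    congrArg (fun F : defect B →L[ℂ] defect B => F g) (hmul x (ofReal_mem_slit hx)).1
  have hmul₁ : ∀ x : ℝ, x < 0 → ∀ g, Q₁ B B₀ B₁ x (Q₀ B B₀ B₁ x g) = -g := fun x hx g =>
    congrArg (fun F : defect B →L[ℂ] defect B => F g) (hmul x (ofReal_mem_slit hx)).2
  have hlim₀ : ∀ g, Tendsto (fun x : ℝ => Q₀ B B₀ B₁ x g) (𝓝[<] 0) (𝓝 0) := fun g => by
    have hAe : 1 - (B₀ + (B₁ - B₀)) = 1 - B₁ := by abel
    refine (tendsto_weylFun_neg_one_zero hD hpair.ker_eq hsa₀ hn₀ ?_ ?_ g).congr' ?_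
    · rw [hAe]
      exact sub_nonneg.2 hu₁
    · rw [hAe]
      exact hpair.range_inf_range_one_sub
    · filter_upwards [self_mem_nhdsWithin] with x hx
      rw [e₀ x (ofReal_mem_slit hx)]
  have hlim₁ : ∀ g, Tendsto (fun x : ℝ => Q₁ B B₀ B₁ x g) atBot (𝓝 0) := fun g => by
    have hAe : 1 + (B₁ - (B₁ - B₀)) = 1 + B₀ := by abel
    refine (tendsto_weylFun_one_atBot hD hpair.ker_eq hsa₁ hn₁ ?_ ?_ g).congr' ?_
    · rw [hAe]
      exact neg_le_iff_add_nonneg'.1 hl₀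
    · rw [hAe]
      exact hpair.range_inf_range_one_add
    · filter_upwards [eventually_lt_atBot (0 : ℝ)] with x hx
      rw [e₁ x (ofReal_mem_slit hx)]
  have hbot₀ : ∀ g, Tendsto (fun x : ℝ => (x : ℂ)⁻¹ • Q₀ B B₀ B₁ x g) atBot (𝓝 0) := fun g => by
    refine (tendsto_inv_smul_weylFun_atBot hs hsa₀ hn₀ (neg_le_iff_add_nonneg'.1 hl₀)
      hker₀ (-1) g).congr' ?_
    filter_upwards [eventually_lt_atBot (0 : ℝ)] with x hx
    rw [e₀ x (ofReal_mem_slit hx)]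
  have hneg₀ : ∀ x : ℝ, x < -1 → 0 ≤ -Q₀ B B₀ B₁ x := fun x hx => by
    rw [e₀ x (ofReal_mem_slit (by linarith))]
    exact neg_weylFun_neg_one_nonneg hs hsa hsa₀ hn₀ hx
  refine ⟨⟨hz₀, fun z hz => ?_, hlim₀, fun g hg => ?_, hbot₀⟩,
    ⟨hz₁, fun z hz => ?_, fun g hg => ?_, hlim₁, fun g hg => ?_⟩, hmul⟩
  · exact ⟨⟨Q₀ B B₀ B₁ z, -Q₁ B B₀ B₁ z, by rw [mul_neg, (hmul z hz).1, neg_neg],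
      by rw [neg_mul, (hmul z hz).2, neg_neg]⟩, rfl⟩
  · rw [← tendsto_neg_atTop_iff]
    -- Duality with `q = -Q₀(x)` and `v = Q₁(x) g → 0`.
    refine tendsto_atTop_of_le_mul (pow_pos (norm_pos_iff.2 hg) 3)
      (fun x => norm_nonneg (Q₁ B B₀ B₁ (x : ℝ) g)) (by simpa using (hlim₁ g).norm) ?_
    filter_upwards [eventually_lt_atBot (-1 : ℝ)] with x hx
    have h1 : (-Q₀ B B₀ B₁ x) (Q₁ B B₀ B₁ x g) = g := by
      rw [neg_apply, hmul₀ x (by linarith), neg_neg]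
    have := pow_norm_le_of_apply_eq (hneg₀ x hx) h1
    rwa [neg_apply, inner_neg_right, Complex.neg_re] at this
  · exact ⟨⟨Q₁ B B₀ B₁ z, -Q₀ B B₀ B₁ z, by rw [mul_neg, (hmul z hz).2, neg_neg],
      by rw [neg_mul, (hmul z hz).1, neg_neg]⟩, rfl⟩
  · refine tendsto_atTop_of_le_mul (pow_pos (norm_pos_iff.2 hg) 3)
      (fun x => norm_nonneg (Q₀ B B₀ B₁ (x : ℝ) g)) (by simpa using (hlim₀ g).norm) ?_
    filter_upwards [Ioo_mem_nhdsLT (show (-1 : ℝ) < 0 by norm_num)] with x hx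
    have h1 : Q₁ B B₀ B₁ x (-Q₀ B B₀ B₁ x g) = g := by
      rw [map_neg, hmul₁ x hx.2, neg_neg]
    have h2 : 0 ≤ Q₁ B B₀ B₁ x := by
      rw [e₁ x (ofReal_mem_slit hx.2)]
      exact weylFun_one_nonneg hs hsa hsa₁ hn₁ hx.1 hx.2
    have := pow_norm_le_of_apply_eq h2 h1
    rwa [norm_neg] at this
  · rw [← tendsto_neg_atTop_iff]
    -- Duality with `q = Q₁(x)` and `v = -Q₀(x) g`; the factor `-x` is balanced by `x⁻¹ Q₀(x) g →
    -- 0`.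
    refine tendsto_atTop_of_le_mul (pow_pos (norm_pos_iff.2 hg) 3)
      (fun x => norm_nonneg ((x : ℂ)⁻¹ • Q₀ B B₀ B₁ (x : ℝ) g))
      (by simpa using (hbot₀ g).norm) ?_
    filter_upwards [eventually_lt_atBot (-1 : ℝ)] with x hx
    have hx0 : x < 0 := by linarith
    have h1 : Q₁ B B₀ B₁ x (-Q₀ B B₀ B₁ x g) = g := by
      rw [map_neg, hmul₁ x hx0, neg_neg]
    -- For `x < -1` the second term of `Q₁(x)` is nonpositive, so the sign of `Q₁(x)` is read off
    -- from `-Q₀(x) ≥ 0` instead.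
    have h2 : 0 ≤ Q₁ B B₀ B₁ x := nonneg_of_neg_mul_eq_neg_one (hneg₀ x hx)
      (hz₁.isSelfAdjoint hx0) (hmul x (ofReal_mem_slit hx0)).1
    have := pow_norm_le_of_apply_eq h2 h1
    rw [norm_neg] at this
    rw [norm_smul, norm_inv, Complex.norm_real, Real.norm_of_nonpos hx0.le]
    refine this.trans_eq ?_
    have := hx0.ne
    field_simp
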